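/- All graphs are finite and simple. A graph $A$ is homomorphic to a graph $B$, written $A \to B$, if there is a map $V(A)\to V(B)$ sending edges to edges; otherwise write $A \nrightarrow B$. The girth of a graph is the length of its shortest cycle, and is $\infty$ if the graph has no cycle. An $n$-vertex graph is $\varepsilon$-far from $F$-free if it cannot be made $F$-free (that is, containing no, not necessarily induced, copy of $F$) by deleting fewer than $\varepsilon n^2$ edges. A graph $H$ is $F$-abundant if there are constants $c>0$ and $C\ge 0$, depending only on $H$ and $F$, such that for every $\varepsilon>0$ and all $n \ge n_0(\varepsilon, H, F)$, every $n$-vertex graph that is $\varepsilon$-far from $F$-free contains at least $c\,\varepsilon^{C} n^{|V(H)|}$ copies of $H$. Let $\ell$ be a non-negative integer and let $F$ and $G$ be graphs with $F \nrightarrow G$. Then there is an $F$-abundant graph $H$ with girth greater than $\ell$ and $H \nrightarrow G$. -/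

import Mathlib

namespace SimpleGraph

open Classical in
/-- A graph `Γ` on `n = |V|` vertices is `ε`-far from `F`-free: it cannot be made `F`-free by
deleting fewer than `ε * n ^ 2` edges, where `F`-free means containing no (not necessarily induced)
copy of `F`. -/
def FarFromFree {V W : Type*} [Fintype V] (Γ : SimpleGraph V) (F : SimpleGraph W) (ε : ℝ) : Prop :=
  Γ.DeleteFar (fun Γ' => F.Free Γ') (ε * (Fintype.card V : ℝ) ^ 2)

/-- `H` is `F`-abundant: for all `ε > 0` and all sufficiently large `n`, every `n`-vertex graph that
is `ε`-far from `F`-free contains at least `poly(ε) * n ^ |H|` copies of `H`, where the polynomial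
bound `poly(ε) = c * ε ^ C` depends only on `H` and `F` (and "sufficiently large" may depend on
`ε`, `H` and `F`). Copies are counted as subgraphs isomorphic to `H`. -/
def IsAbundant {U W : Type*} [Fintype U] (H : SimpleGraph U) (F : SimpleGraph W) : Prop :=
  ∃ (c : ℝ) (C : ℕ), 0 < c ∧ ∀ ε : ℝ, 0 < ε → ∃ n₀ : ℕ, ∀ n : ℕ, n₀ ≤ n →
    ∀ Γ : SimpleGraph (Fin n), Γ.FarFromFree F ε →
      c * ε ^ C * (n : ℝ) ^ Fintype.card U ≤ (Γ.copyCount H : ℝ)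

end SimpleGraph

/-!
A graph `Γ` that is `ε`-far from `F`-free contains a packing: a family `T` of `Ω(ε n ^ 2)`
homomorphisms from `F` to `Γ` in which an edge of `Γ`, placed at a given edge of `F`, determines the
member (`FarFromFree.exists_packing`). The graph `H` is found in such packings.

*Lists.* Suppose that vertices labelled `i ∈ V(F)` may only use colours of `G` from a list `L i`.
Call `L` avoidable if some graph with labelled vertices has no such colouring, but has polynomially
many homomorphisms into every dense packing that respect the labels. Let `i j` be an edge of `F`.
For linearly many vertices `a` in position `i` of the packing, the members of `T` whose `j`-th
vertex is joined to `a` by an edge of the packing form again a dense packing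
(`IsPacking.exists_popular`). If `a` is coloured `g`, then in this subpacking the list `L j` shrinks
to the neighbours of `g` in it. The neighbour `j` may be chosen depending on `g`: hanging from
the single root `a` one graph for each colour `g` shows that `L` is avoidable if all the
shortened lists are (`ListAvoidable.of_root`). Now let `L` be minimal among the lists that
are not avoidable. No root shortens `L`, so for every `i` there is a colour
`g i ∈ L i` adjacent to all colours in `L j`, for all neighbours `j` of `i`. Then `g` is a
homomorphism from `F` to `G`, a contradiction. Hence the full lists are avoidable, which gives an
abundant graph `H₀` that is not homomorphic to `G` (`listAvoidable_univ`, `exists_homAbundant`).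

*Girth.* By convexity, a set of maps `U → X` of density `β` contains a power of `β` of all blow-ups
(`le_card_blowUpMaps`), so abundance passes to every graph homomorphic to `H₀`
(`HomAbundant.of_hom`). It remains to find such a graph of large girth that is still not homomorphic
to `G`, which is the sparse incomparability lemma `exists_lt_egirth_hom`. It is proved by adding
edges of a large blow-up of `H₀` greedily. Each colouring of the blow-up by `G` violates a positive
proportion of its edges, while short cycles and large degrees block only few pairs, so each new edge
can be chosen to remove a positive proportion of the colourings that are left.

Finally, most homomorphisms into a large graph are injective, and boundedly many of them give the
same copy (`HomAbundant.isAbundant`).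
-/

namespace SimpleGraph

open Finset

universe w
variable {V U U' X Y K : Type*} {W : Type w}

/-! ### Packings -/

/-- A family `T` of homomorphisms from `F` to `Γ`, given as maps of vertices, in which no ordered
edge of `Γ` is the image of the same ordered edge of `F` under two different members. -/
structure IsPacking (F : SimpleGraph V) (Γ : SimpleGraph X) (T : Finset (V → X)) : Prop where
  adj : ∀ t ∈ T, ∀ i j, F.Adj i j → Γ.Adj (t i) (t j)
  eq : ∀ s ∈ T, ∀ t ∈ T, ∀ i j, F.Adj i j → s i = t i → s j = t j → s = t

lemma IsPacking.mono {F : SimpleGraph V} {Γ : SimpleGraph X} {S T : Finset (V → X)}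
    (hT : IsPacking F Γ T) (hST : S ⊆ T) : IsPacking F Γ S :=
  ⟨fun t ht => hT.adj t (hST ht), fun s hs t ht => hT.eq s (hST hs) t (hST ht)⟩

open Classical in
/-- The edges of the members of a maximal edge-disjoint family of copies of `F` meet every copy of
`F`, so a graph far from `F`-free has a large family of this kind. -/
lemma FarFromFree.exists_packing [Fintype V] [Fintype X] {F : SimpleGraph V} {Γ : SimpleGraph X}
    {ε : ℝ} (h : Γ.FarFromFree F ε) {v w : V} (hvw : F.Adj v w) :
    ∃ T : Finset (V → X), IsPacking F Γ T ∧
      ε * (Fintype.card X : ℝ) ^ 2 ≤ #T * (Fintype.card V : ℝ) ^ 2 := by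
  let P : Set (Finset (V → X)) := {T | (∀ t ∈ T, ∀ i j, F.Adj i j → Γ.Adj (t i) (t j)) ∧
    ∀ s ∈ T, ∀ t ∈ T, ∀ i j i' j', F.Adj i j → F.Adj i' j' →
      s(s i, s j) = s(t i', t j') → s = t}
  obtain ⟨T, hTmax⟩ := (Set.toFinite P).exists_maximal ⟨∅, by simp [P]⟩
  have hT : T ∈ P := hTmax.prop
  refine ⟨T, ⟨hT.1, fun s hs t ht i j hij hi hj => hT.2 s hs t ht i j i j hij hij
    (by rw [hi, hj])⟩, ?_⟩
  let D : Finset (Sym2 X) := (T ×ˢ (univ : Finset (V × V))).image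
    (fun p => s(p.1 p.2.1, p.1 p.2.2)) ∩ Γ.edgeFinset
  have hD : F.Free (Γ.deleteEdges D) := by
    rintro ⟨f⟩
    have hfadj : ∀ i j, F.Adj i j → Γ.Adj (f i) (f j) ∧ s(f i, f j) ∉ D := by
      intro i j hij
      have := f.toHom.map_adj hij
      simpa using this
    have hfD : ∀ t ∈ T, ∀ i j i' j', F.Adj i j → s(f i, f j) ≠ s(t i', t j') := by
      intro t ht i j i' j' hij heq
      refine (hfadj i j hij).2
        (mem_inter.2 ⟨mem_image.2 ⟨(t, (i', j')), by simp [ht], heq.symm⟩, ?_⟩)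
      simpa using (hfadj i j hij).1
    have hins : insert (f : V → X) T ∈ P := by
      refine ⟨?_, ?_⟩
      · intro t ht
        rcases mem_insert.1 ht with rfl | ht
        · exact fun i j hij => (hfadj i j hij).1
        · exact hT.1 t ht
      · intro s hs t ht i j i' j' hij hij' heq
        rcases mem_insert.1 hs with rfl | hs <;> rcases mem_insert.1 ht with rfl | ht
        · rfl
        · exact (hfD t ht i j i' j' hij heq).elim
        · exact (hfD s hs i' j' i j hij' heq.symm).elim
        · exact hT.2 s hs t ht i j i' j' hij hij' heq
    have hfT : (f : V → X) ∈ T := hTmax.le_of_ge hins (subset_insert _ _) (mem_insert_self _ _)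
    exact hfD f hfT v w v w hvw rfl
  have hle : ε * (Fintype.card X : ℝ) ^ 2 ≤ #D := by
    have hs : D ⊆ Γ.edgeFinset := inter_subset_right
    have h' := @h D
    refine (h' ?_ ?_)
    · convert hs
    · convert hD
  refine hle.trans ?_
  have : #D ≤ #T * Fintype.card V ^ 2 := by
    refine (card_le_card inter_subset_left).trans (card_image_le.trans ?_)
    simp [card_product, sq]
  exact_mod_cast this

open Classical in
/-- A root `a` is popular for a dense packing `T` and a non-isolated vertex `i` if it is the `i`-th
vertex of a member of `T` and, for each neighbour `j` of `i`, the members of `T` whose `j`-th vertex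
also lies on a member of `T` rooted at `a` are dense. Linearly many vertices are popular. -/
lemma IsPacking.exists_popular [Fintype V] [Fintype X] {F : SimpleGraph V} {Γ : SimpleGraph X}
    {T : Finset (V → X)} (hT : IsPacking F Γ T) {i k : V} (hik : F.Adj i k) {δ : ℝ} (hδ : 0 < δ)
    (hcard : δ * (Fintype.card X : ℝ) ^ 2 ≤ #T) :
    ∃ A : Finset X, δ / 4 * Fintype.card X ≤ #A ∧ ∀ a ∈ A, (∃ t ∈ T, t i = a) ∧
      ∀ j, F.Adj i j → δ ^ 2 / (8 * Fintype.card V) * (Fintype.card X : ℝ) ^ 2 ≤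
        #{t ∈ T | ∃ s ∈ T, s i = a ∧ s j = t j} := by
  rcases Nat.eq_zero_or_pos (Fintype.card X) with hX | hX
  · exact ⟨∅, by simp [hX], by simp⟩
  have hVpos : 0 < Fintype.card V := Fintype.card_pos_iff.2 ⟨i⟩
  set n : ℝ := (Fintype.card X : ℝ) with hn
  set v : ℝ := (Fintype.card V : ℝ) with hv
  have hn0 : 0 < n := by rw [hn]; exact_mod_cast hX
  have hv0 : 0 < v := by rw [hv]; exact_mod_cast hVpos
  set η : ℝ := δ / (4 * v) with hη
  have hη0 : 0 < η := by positivity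
  let e : V → X → ℕ := fun j x => #{t ∈ T | t j = x}
  -- The members all of whose vertices lie on many members make up most of `T`.
  let good : Finset (V → X) := {s ∈ T | ∀ j, η * n ≤ e j (s j)}
  have hbad : (#(T \ good) : ℝ) ≤ δ / 4 * n ^ 2 := by
    have hsub : T \ good ⊆ (univ : Finset V).biUnion fun j =>
        ({x | (e j x : ℝ) < η * n} : Finset X).biUnion fun x => {t ∈ T | t j = x} := by
      intro t ht
      simp only [good, mem_sdiff, mem_filter, not_and, not_forall, not_le] at ht
      obtain ⟨htT, h⟩ := ht
      obtain ⟨j, hj⟩ := h htT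
      simp only [mem_biUnion, mem_univ, true_and, mem_filter]
      exact ⟨j, t j, hj, htT, rfl⟩
    have h1 : (#(T \ good) : ℝ) ≤ ∑ j : V, ∑ x ∈ ({x | (e j x : ℝ) < η * n} : Finset X),
        (e j x : ℝ) := by
      have : #(T \ good) ≤ ∑ j : V, ∑ x ∈ ({x | (e j x : ℝ) < η * n} : Finset X), e j x :=
        (card_le_card hsub).trans (card_biUnion_le.trans (sum_le_sum fun j _ => card_biUnion_le))
      exact_mod_cast this
    refine h1.trans ?_
    calc ∑ j : V, ∑ x ∈ ({x | (e j x : ℝ) < η * n} : Finset X), (e j x : ℝ)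
        ≤ ∑ j : V, n * (η * n) := by
          refine sum_le_sum fun j _ => ?_
          calc _ ≤ ∑ x ∈ ({x | (e j x : ℝ) < η * n} : Finset X), η * n :=
                sum_le_sum fun x hx => (mem_filter.1 hx).2.le
            _ ≤ n * (η * n) := by
                rw [sum_const, nsmul_eq_mul]
                refine mul_le_mul_of_nonneg_right ?_ (by positivity)
                rw [hn]; exact_mod_cast card_le_univ _
      _ = δ / 4 * n ^ 2 := by
          rw [sum_const, nsmul_eq_mul, card_univ, ← hv, hη]
          field_simp
  have hgoodT : good ⊆ T := filter_subset _ _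
  have hgood : 3 / 4 * δ * n ^ 2 ≤ #good := by
    have : (#(T \ good) : ℝ) + #good = #T := by exact_mod_cast card_sdiff_add_card_eq_card hgoodT
    linarith
  let d : X → ℕ := fun a => #{s ∈ good | s i = a}
  -- Members with the same root `a` differ at the neighbour `k` of `i`.
  have hd : ∀ a, (d a : ℝ) ≤ n := by
    intro a
    have : d a ≤ #(univ : Finset X) := by
      refine card_le_card_of_injOn (fun s => s k) (by simp) ?_
      intro s hs t ht hst
      have hs := mem_filter.1 (mem_coe.1 hs)
      have ht := mem_filter.1 (mem_coe.1 ht)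
      exact hT.eq s (hgoodT hs.1) t (hgoodT ht.1) i k hik (hs.2.trans ht.2.symm) hst
    rw [hn]; exact_mod_cast this
  have hsum : (#good : ℝ) = ∑ a, (d a : ℝ) := by
    exact_mod_cast card_eq_sum_card_fiberwise (f := fun s : V → X => s i) (t := univ) (by simp)
  let A : Finset X := {a | δ * n / 2 ≤ d a}
  refine ⟨A, ?_, ?_⟩
  · have h1 : ∑ a, (d a : ℝ) ≤ ∑ a, ((if a ∈ A then n else 0) + δ * n / 2) := by
      refine sum_le_sum fun a _ => ?_
      split_ifs with ha
      · have := hd a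
        have : 0 ≤ δ * n / 2 := by positivity
        linarith [hd a]
      · simp only [A, mem_filter, mem_univ, true_and, not_le] at ha
        linarith
    rw [sum_add_distrib, sum_ite_mem, univ_inter, sum_const, sum_const, nsmul_eq_mul, nsmul_eq_mul,
      card_univ, ← hn, ← hsum] at h1
    have h2 : (δ / 4 * n) * n ≤ #A * n := by nlinarith
    exact le_of_mul_le_mul_right h2 hn0
  · intro a ha
    have had : δ * n / 2 ≤ d a := (mem_filter.1 ha).2
    constructor
    · have : 0 < d a := by
        have : (0 : ℝ) < d a := lt_of_lt_of_le (by positivity) had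
        exact_mod_cast this
      obtain ⟨s, hs⟩ := card_pos.1 this
      exact ⟨s, hgoodT (mem_filter.1 hs).1, (mem_filter.1 hs).2⟩
    · intro j hij
      have hsub : ({s ∈ good | s i = a} : Finset (V → X)).biUnion
          (fun s => ({t ∈ T | t j = s j} : Finset (V → X))) ⊆
          {t ∈ T | ∃ s ∈ T, s i = a ∧ s j = t j} := by
        intro t ht
        simp only [mem_biUnion, mem_filter] at ht ⊢
        obtain ⟨s, ⟨hs, hsa⟩, ht, hts⟩ := ht
        exact ⟨ht, s, hgoodT hs, hsa, hts.symm⟩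
      have hdisj : ((({s ∈ good | s i = a} : Finset (V → X)) : Set (V → X))).PairwiseDisjoint
          (fun s => ({t ∈ T | t j = s j} : Finset (V → X))) := by
        intro s hs t ht hst
        have hs := mem_filter.1 (mem_coe.1 hs)
        have ht := mem_filter.1 (mem_coe.1 ht)
        refine Finset.disjoint_left.2 fun u hu hu' => hst ?_
        exact hT.eq s (hgoodT hs.1) t (hgoodT ht.1) i j hij (hs.2.trans ht.2.symm)
          ((mem_filter.1 hu).2.symm.trans (mem_filter.1 hu').2)
      have hle := card_le_card hsub
      rw [card_biUnion hdisj] at hle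
      have hle' : (∑ s ∈ ({s ∈ good | s i = a} : Finset (V → X)), (e j (s j) : ℝ)) ≤
          #{t ∈ T | ∃ s ∈ T, s i = a ∧ s j = t j} := by exact_mod_cast hle
      refine le_trans ?_ hle'
      calc δ ^ 2 / (8 * v) * n ^ 2 = (δ * n / 2) * (η * n) := by rw [hη]; field_simp; ring
        _ ≤ d a * (η * n) := by gcongr
        _ = ∑ s ∈ ({s ∈ good | s i = a} : Finset (V → X)), η * n := by
            rw [sum_const, nsmul_eq_mul]
        _ ≤ _ := sum_le_sum fun s hs => (mem_filter.1 (mem_filter.1 hs).1).2 j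

/-! ### Colourings from lists -/

/-- Adjacency in the graph obtained from the disjoint union of graphs `H g` by adding a root,
`none`, joined to the vertices satisfying `P`. -/
inductive RootedSumAdj {ι : Type*} {U : ι → Type*} (H : ∀ g, SimpleGraph (U g))
    (P : (Σ g, U g) → Prop) : Option (Σ g, U g) → Option (Σ g, U g) → Prop
  | root_left (p : Σ g, U g) : P p → RootedSumAdj H P none (some p)
  | root_right (p : Σ g, U g) : P p → RootedSumAdj H P (some p) none
  | inner (g : ι) (u v : U g) : (H g).Adj u v → RootedSumAdj H P (some ⟨g, u⟩) (some ⟨g, v⟩)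

/-- The disjoint union of the graphs `H g` with an additional vertex, the root `none`, joined to the
vertices satisfying `P`. -/
def rootedSum {ι : Type*} {U : ι → Type*} (H : ∀ g, SimpleGraph (U g))
    (P : (Σ g, U g) → Prop) : SimpleGraph (Option (Σ g, U g)) where
  Adj := RootedSumAdj H P
  symm := ⟨by
    rintro _ _ (⟨p, hp⟩ | ⟨p, hp⟩ | ⟨g, u, v, h⟩)
    exacts [.root_right p hp, .root_left p hp, .inner g v u h.symm]⟩
  loopless := ⟨by
    intro x hx
    rcases hx with _ | _ | ⟨g, u, v, h⟩
    exact (H g).irrefl h⟩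

open Classical in
/-- The homomorphisms `ψ` from `H` to `Γ`, given as maps of vertices, that send each vertex `u` to
the `τ u`-th vertex of some member of `T`. -/
noncomputable def typedHoms [Fintype U] [Fintype X] (H : SimpleGraph U) (Γ : SimpleGraph X)
    (τ : U → V) (T : Finset (V → X)) : Finset (U → X) :=
  {ψ | (∀ u v, H.Adj u v → Γ.Adj (ψ u) (ψ v)) ∧ ∀ u, ∃ t ∈ T, t (τ u) = ψ u}

lemma mem_typedHoms [Fintype U] [Fintype X] {H : SimpleGraph U} {Γ : SimpleGraph X}
    {τ : U → V} {T : Finset (V → X)} {ψ : U → X} :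
    ψ ∈ typedHoms H Γ τ T ↔
      (∀ u v, H.Adj u v → Γ.Adj (ψ u) (ψ v)) ∧ ∀ u, ∃ t ∈ T, t (τ u) = ψ u := by
  classical simp [typedHoms]

/-- `G` is *list-avoidable* with respect to the lists `L` if some graph `H`, whose vertices are
labelled by vertices of `F`, has no `G`-colouring in which each vertex labelled `i` gets a colour
from `L i`, while every dense packing of `F` admits polynomially many homomorphisms of `H` that
respect the labels. -/
def ListAvoidable (F : SimpleGraph V) (G : SimpleGraph W) (L : V → Set W) : Prop :=
  ∃ (U : Type w) (_ : Fintype U) (H : SimpleGraph U) (τ : U → V),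
    (∀ φ : H →g G, ∃ u, φ u ∉ L (τ u)) ∧ ∃ (c : ℝ) (C : ℕ), 0 < c ∧
      ∀ (n : ℕ) (Γ : SimpleGraph (Fin n)) (T : Finset (V → Fin n)) (δ : ℝ), IsPacking F Γ T →
        0 < δ → δ * (n : ℝ) ^ 2 ≤ #T →
          c * δ ^ C * (n : ℝ) ^ Fintype.card U ≤ #(typedHoms H Γ τ T)

open Classical in
/-- The colour `g` of a new root labelled `i` removes the non-neighbours of `g` from the list of
the label `j g`. A popular root leaves a dense packing for each of the labels `j g`, so the graphs
that deal with the shortened lists can all be hung from it. -/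
lemma ListAvoidable.of_root [Fintype V] [Fintype W] {F : SimpleGraph V} {G : SimpleGraph W}
    {L : V → Set W} {i k : V} (hik : F.Adj i k) (j : W → V)
    (hj : ∀ g ∈ L i, F.Adj i (j g) ∧
      ListAvoidable F G (Function.update L (j g) (L (j g) ∩ G.neighborSet g))) :
    ListAvoidable F G L := by
  have hj1 : ∀ g : L i, F.Adj i (j g) := fun g => (hj g g.2).1
  have hj2 : ∀ g : L i, ListAvoidable F G
    (Function.update L (j g) (L (j g) ∩ G.neighborSet (g : W))) := fun g => (hj g g.2).2
  choose U instU H τ hcol c C hc hcount using hj2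
  have hVpos : 0 < Fintype.card V := Fintype.card_pos_iff.2 ⟨i⟩
  have hv0 : (0 : ℝ) < Fintype.card V := by exact_mod_cast hVpos
  refine ⟨Option (Σ g : L i, U g), inferInstance,
    rootedSum H (fun p => τ p.1 p.2 = j p.1), fun x => x.elim i (fun p => τ p.1 p.2), ?_, ?_⟩
  · intro φ
    by_contra! hφ
    let g : L i := ⟨φ none, hφ none⟩
    obtain ⟨u, hu⟩ := hcol g ⟨fun u => φ (some ⟨g, u⟩), fun {u v} huv =>
      φ.map_adj (RootedSumAdj.inner g u v huv)⟩
    refine hu ?_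
    have hL : φ (some ⟨g, u⟩) ∈ L (τ g u) := hφ (some ⟨g, u⟩)
    change φ (some ⟨g, u⟩) ∈ _
    by_cases hτ : τ g u = j g
    · rw [hτ, Function.update_self]
      rw [hτ] at hL
      exact ⟨hL, φ.map_adj (RootedSumAdj.root_left ⟨g, u⟩ hτ)⟩
    · rwa [Function.update_of_ne hτ]
  · refine ⟨1 / 4 * ∏ g, (c g * (1 / (8 * Fintype.card V)) ^ C g), 1 + 2 * ∑ g, C g, ?_, ?_⟩
    · have : 0 < ∏ g, (c g * (1 / (8 * (Fintype.card V : ℝ))) ^ C g) :=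
        prod_pos fun g _ => mul_pos (hc g) (by positivity)
      positivity
    intro n Γ T δ hT hδ hcard
    obtain ⟨A, hA, hApop⟩ := hT.exists_popular hik hδ (by simpa using hcard)
    rw [Fintype.card_fin] at hA hApop
    set δ' : ℝ := δ ^ 2 / (8 * Fintype.card V) with hδ'
    have hδ'0 : 0 < δ' := by positivity
    let T' : Fin n → L i → Finset (V → Fin n) := fun a g =>
      {t ∈ T | ∃ s ∈ T, s i = a ∧ s (j g) = t (j g)}
    let S : Fin n → Finset (∀ g : L i, U g → Fin n) := fun a =>
      Fintype.piFinset fun g => typedHoms (H g) Γ (τ g) (T' a g)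
    have hS : ∀ a ∈ A, (∏ g, (c g * (1 / (8 * Fintype.card V)) ^ C g)) * δ ^ (2 * ∑ g, C g) *
        (n : ℝ) ^ ∑ g, Fintype.card (U g) ≤ #(S a) := by
      intro a ha
      calc _ = ∏ g, (c g * δ' ^ C g * (n : ℝ) ^ Fintype.card (U g)) := by
            rw [prod_mul_distrib, prod_mul_distrib, prod_mul_distrib, prod_pow_eq_pow_sum,
              prod_pow_eq_pow_sum, prod_pow_eq_pow_sum, hδ', div_eq_mul_one_div, mul_pow, pow_mul]
            ring
        _ ≤ ∏ g, (#(typedHoms (H g) Γ (τ g) (T' a g)) : ℝ) := by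
            refine prod_le_prod (fun g _ => ?_) fun g _ => ?_
            · have := hc g
              positivity
            · exact hcount g n Γ (T' a g) δ' (hT.mono (filter_subset _ _)) hδ'0
                (by convert (hApop a ha).2 (j g) (hj1 g))
        _ = #(S a) := by rw [Fintype.card_piFinset]; push_cast; rfl
    let f : (Σ _ : Fin n, ∀ g : L i, U g → Fin n) → Option (Σ g : L i, U g) → Fin n :=
      fun q x => x.elim q.1 (fun p => q.2 p.1 p.2)
    have hf : Function.Injective f := by
      rintro ⟨a, p⟩ ⟨b, q⟩ h
      have h1 : a = b := congrFun h none
      have h2 : p = q := by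
        funext g u
        exact congrFun h (some ⟨g, u⟩)
      rw [h1, h2]
    have hmaps : ∀ q ∈ A.sigma S, f q ∈ typedHoms
        (rootedSum H (fun p => τ p.1 p.2 = j p.1)) Γ
        (fun x => x.elim i (fun p => τ p.1 p.2)) T := by
      rintro ⟨a, p⟩ hq
      obtain ⟨ha, hp⟩ := mem_sigma.1 hq
      have hp' : ∀ g, p g ∈ typedHoms (H g) Γ (τ g) (T' a g) := Fintype.mem_piFinset.1 hp
      have hroot : ∀ g u, τ g u = j g → Γ.Adj a (p g u) := by
        intro g u hτ
        obtain ⟨t, ht, htu⟩ := (mem_typedHoms.1 (hp' g)).2 u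
        obtain ⟨htT, s, hs, hsa, hst⟩ := mem_filter.1 ht
        have := hT.adj s hs i (j g) (hj1 g)
        rwa [hsa, hst, ← hτ, htu] at this
      refine mem_typedHoms.2 ⟨?_, ?_⟩
      · rintro _ _ (⟨⟨g, u⟩, h⟩ | ⟨⟨g, u⟩, h⟩ | ⟨g, u, v, h⟩)
        · exact hroot g u h
        · exact (hroot g u h).symm
        · exact (mem_typedHoms.1 (hp' g)).1 u v h
      · rintro (_ | ⟨g, u⟩)
        · exact (hApop a ha).1
        · obtain ⟨t, ht, htu⟩ := (mem_typedHoms.1 (hp' g)).2 u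
          exact ⟨t, (mem_filter.1 ht).1, htu⟩
    have hle : #(A.sigma S) ≤ #(typedHoms (rootedSum H (fun p => τ p.1 p.2 = j p.1)) Γ
        (fun x => x.elim i (fun p => τ p.1 p.2)) T) :=
      card_le_card_of_injOn f hmaps hf.injOn
    have hle' : (∑ a ∈ A, (#(S a) : ℝ)) ≤ #(typedHoms
        (rootedSum H (fun p => τ p.1 p.2 = j p.1)) Γ
        (fun x => x.elim i (fun p => τ p.1 p.2)) T) := by
      rw [card_sigma] at hle
      exact_mod_cast hle
    refine le_trans ?_ hle'
    set K : ℝ := ∏ g, (c g * (1 / (8 * Fintype.card V)) ^ C g) with hK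
    have hK0 : 0 < K := prod_pos fun g _ => mul_pos (hc g) (by positivity)
    rw [Fintype.card_option, Fintype.card_sigma]
    calc 1 / 4 * K * δ ^ (1 + 2 * ∑ g, C g) * (n : ℝ) ^ (∑ g, Fintype.card (U g) + 1)
        = (δ / 4 * n) * (K * δ ^ (2 * ∑ g, C g) * (n : ℝ) ^ ∑ g, Fintype.card (U g)) := by ring
      _ ≤ #A * (K * δ ^ (2 * ∑ g, C g) * (n : ℝ) ^ ∑ g, Fintype.card (U g)) := by gcongr
      _ ≤ ∑ a ∈ A, (#(S a) : ℝ) := by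
          rw [← nsmul_eq_mul, ← sum_const]
          exact sum_le_sum hS

open Classical in
/-- Consider minimal lists that are not avoidable. By minimality no root shortens them, so each
non-isolated vertex `i` has a colour in `L i` adjacent to all of `L j` for every neighbour `j` of
`i`. These colours form a homomorphism from `F` to `G`. -/
lemma listAvoidable_univ [Fintype V] [Fintype W] [Nonempty W] {F : SimpleGraph V}
    {G : SimpleGraph W} (hFG : IsEmpty (F →g G)) : ListAvoidable F G fun _ => Set.univ := by
  by_contra hcon
  obtain ⟨L, hL⟩ := (Set.toFinite {L : V → Set W | ¬ ListAvoidable F G L}).exists_minimal ⟨_, hcon⟩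
  have key : ∀ i, ∃ g, ∀ j, F.Adj i j → g ∈ L i ∧ L j ⊆ G.neighborSet g := by
    intro i
    by_cases hi : ∃ k, F.Adj i k
    swap
    · push Not at hi
      exact ⟨Classical.arbitrary W, fun j hj => (hi j hj).elim⟩
    obtain ⟨k, hik⟩ := hi
    by_contra! hno
    have hchoose : ∀ g, ∃ j, F.Adj i j ∧ (g ∈ L i → ¬ L j ⊆ G.neighborSet g) := hno
    choose j hj1 hj2 using hchoose
    refine hL.prop (ListAvoidable.of_root hik j fun g hg => ⟨hj1 g, ?_⟩)
    by_contra hbad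
    have hle : Function.update L (j g) (L (j g) ∩ G.neighborSet g) ≤ L :=
      update_le_self_iff.2 Set.inter_subset_left
    have := hL.le_of_le hbad hle (j g)
    rw [Function.update_self] at this
    exact hj2 g hg fun x hx => (this hx).2
  choose g hg using key
  exact hFG.elim ⟨g, fun {i j} hij => (hg i j hij).2 (hg j i hij.symm).1⟩

/-! ### Blow-ups -/

/-- A form of Jensen's inequality for powers. -/
lemma pow_mul_card_le_sum_pow {ι : Type*} (s : Finset ι) {f : ι → ℝ} (hf : ∀ i ∈ s, 0 ≤ f i)
    {b : ℝ} (hb : 0 ≤ b) (h : b * #s ≤ ∑ i ∈ s, f i) (m : ℕ) :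
    b ^ m * #s ≤ ∑ i ∈ s, f i ^ m := by
  rcases s.eq_empty_or_nonempty with rfl | hs
  · simp
  have hs0 : (0 : ℝ) < #s := by exact_mod_cast hs.card_pos
  rcases m with _ | m
  · simp
  refine le_trans ?_ (pow_sum_div_card_le_sum_pow hf m)
  rw [le_div_iff₀ (by positivity)]
  calc b ^ (m + 1) * #s * (#s : ℝ) ^ m = (b * #s) ^ (m + 1) := by ring
    _ ≤ _ := by gcongr

open Classical in
/-- The maps `Ψ` on the blow-up of `U`, in which each element is replaced by a copy of `K`, such
that every transversal of the blow-up gives a member of `S`. -/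
noncomputable def blowUpMaps [Fintype U] [Fintype X] (K : Type*) [Fintype K]
    (S : Finset (U → X)) : Finset (U → K → X) :=
  {Ψ | ∀ k : U → K, (fun u => Ψ u (k u)) ∈ S}

lemma mem_blowUpMaps [Fintype U] [Fintype X] [Fintype K] {S : Finset (U → X)} {Ψ : U → K → X} :
    Ψ ∈ blowUpMaps K S ↔ ∀ k : U → K, (fun u => Ψ u (k u)) ∈ S := by
  classical simp [blowUpMaps]

open Classical in
/-- By induction on `h`: the coordinate `0` is blown up first, using convexity of `d ↦ d ^ card K`
for the degrees `d` of the other coordinates. For each choice of its `card K` values the fibre is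
then blown up, and convexity is used again to average over these choices. -/
lemma le_card_blowUpMaps_fin [Fintype X] [Fintype K] [Nonempty K] (h : ℕ)
    (S : Finset (Fin h → X)) {β : ℝ} (hβ : 0 ≤ β) (hS : β * (Fintype.card X : ℝ) ^ h ≤ #S) :
    β ^ (Fintype.card K ^ h) * (Fintype.card X : ℝ) ^ (h * Fintype.card K) ≤
      #(blowUpMaps K S) := by
  induction h generalizing β with
  | zero =>
    have hle : #S ≤ #(blowUpMaps K S) := by
      refine card_le_card_of_injOn (fun _ => default) (fun y hy => ?_)
        (fun y _ z _ _ => Subsingleton.elim y z)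
      refine mem_coe.2 (mem_blowUpMaps.2 fun k => ?_)
      rwa [Subsingleton.elim (fun u => (default : Fin 0 → K → X) u (k u)) y]
    have hle' : (#S : ℝ) ≤ #(blowUpMaps K S) := by exact_mod_cast hle
    simpa using hS.trans (by simpa using hle')
  | succ h ih =>
    set m := Fintype.card K with hm
    set n : ℝ := (Fintype.card X : ℝ) with hn
    have hm0 : 0 < m := Fintype.card_pos
    rcases Nat.eq_zero_or_pos (Fintype.card X) with hX | hX
    · have : (h + 1) * m ≠ 0 := by positivity
      rw [hn, hX, Nat.cast_zero, zero_pow this, mul_zero]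
      positivity
    have hn0 : 0 < n := by rw [hn]; exact_mod_cast hX
    -- The fibre of `S` above `m` values of the coordinate `0`.
    let R : (K → X) → Finset (Fin h → X) := fun x =>
      {y | ∀ κ, (Fin.cons (x κ) y : Fin (h + 1) → X) ∈ S}
    let d : (Fin h → X) → Finset X := fun y => {a | (Fin.cons a y : Fin (h + 1) → X) ∈ S}
    have hd : (#S : ℝ) ≤ ∑ y, (#(d y) : ℝ) := by
      have : #S ≤ #((univ : Finset (Fin h → X)).sigma d) := by
        refine card_le_card_of_injOn (fun z => ⟨Fin.tail z, z 0⟩) (fun z hz => ?_) ?_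
        · simpa [d] using hz
        · intro z _ z' _ hzz
          simp only [Sigma.mk.injEq, heq_eq_eq] at hzz
          rw [← Fin.cons_self_tail z, ← Fin.cons_self_tail z', hzz.1, hzz.2]
      rw [card_sigma] at this
      exact_mod_cast this
    have hRd : ∑ y, (#(d y) : ℝ) ^ m ≤ ∑ x, (#(R x) : ℝ) := by
      have : #((univ : Finset (Fin h → X)).sigma fun y => Fintype.piFinset fun _ : K => d y) ≤
          #((univ : Finset (K → X)).sigma R) := by
        refine card_le_card_of_injOn (fun z => ⟨z.2, z.1⟩) (fun z hz => ?_) ?_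
        · have hz' := (mem_sigma.1 hz).2
          refine mem_coe.2 (mem_sigma.2 ⟨mem_univ _, mem_filter.2 ⟨mem_univ _, fun κ => ?_⟩⟩)
          exact (mem_filter.1 (Fintype.mem_piFinset.1 hz' κ)).2
        · rintro ⟨y, x⟩ _ ⟨y', x'⟩ _ hzz
          simp only [Sigma.mk.injEq, heq_eq_eq] at hzz ⊢
          exact ⟨hzz.2, hzz.1⟩
      rw [card_sigma, card_sigma] at this
      simp only [Fintype.card_piFinset, prod_const, card_univ] at this
      exact_mod_cast this
    have hblow : ∑ x, (#(blowUpMaps K (R x)) : ℝ) ≤ #(blowUpMaps K S) := by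
      have : #((univ : Finset (K → X)).sigma fun x => blowUpMaps K (R x)) ≤ #(blowUpMaps K S) := by
        refine card_le_card_of_injOn
          (fun z => (Fin.cons z.1 z.2 : Fin (h + 1) → K → X)) (fun z hz => ?_) ?_
        · have hz' := mem_blowUpMaps.1 (mem_sigma.1 hz).2
          refine mem_coe.2 (mem_blowUpMaps.2 fun k => ?_)
          have := (mem_filter.1 (hz' (Fin.tail k))).2 (k 0)
          convert this using 1
          funext u
          refine Fin.cases ?_ (fun u => ?_) u <;> simp [Fin.tail]
        · rintro ⟨x, y⟩ _ ⟨x', y'⟩ _ hzz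
          have : x = x' ∧ y = y' := Fin.cons_injective2 hzz
          rw [this.1, this.2]
      rw [card_sigma] at this
      exact_mod_cast this
    have hcardY : (#(univ : Finset (Fin h → X)) : ℝ) = n ^ h := by simp [hn]
    have hcardX : (#(univ : Finset (K → X)) : ℝ) = n ^ m := by simp [hn, hm]
    have h1 : (β * n) ^ m * n ^ h ≤ ∑ y, (#(d y) : ℝ) ^ m := by
      rw [← hcardY]
      refine pow_mul_card_le_sum_pow _ (fun _ _ => by positivity) (by positivity) ?_ m
      rw [hcardY]
      calc β * n * n ^ h = β * n ^ (h + 1) := by ring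
        _ ≤ _ := hS.trans hd
    have h2 : β ^ m * n ^ m ≤ ∑ x, (#(R x) : ℝ) / n ^ h := by
      rw [← sum_div, le_div_iff₀ (by positivity), ← mul_pow]
      exact h1.trans hRd
    have h3 : (β ^ m) ^ (m ^ h) * n ^ m ≤ ∑ x, ((#(R x) : ℝ) / n ^ h) ^ (m ^ h) := by
      rw [← hcardX]
      refine pow_mul_card_le_sum_pow _ (fun _ _ => by positivity) (by positivity) ?_ _
      rwa [hcardX]
    refine le_trans ?_ hblow
    calc β ^ m ^ (h + 1) * n ^ ((h + 1) * m)
        = (β ^ m) ^ (m ^ h) * n ^ m * n ^ (h * m) := by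
          rw [← pow_mul, ← pow_succ', mul_assoc, ← pow_add]
          congr 2
          ring
      _ ≤ (∑ x, ((#(R x) : ℝ) / n ^ h) ^ (m ^ h)) * n ^ (h * m) := by gcongr
      _ = ∑ x, ((#(R x) : ℝ) / n ^ h) ^ (m ^ h) * n ^ (h * m) := sum_mul _ _ _
      _ ≤ ∑ x, (#(blowUpMaps K (R x)) : ℝ) := by
          refine sum_le_sum fun x _ => ih (R x) (by positivity) ?_
          rw [div_mul_cancel₀ _ (by positivity)]

/-- A set of maps `U → X` of density `β` has polynomially many blow-ups. -/
lemma le_card_blowUpMaps [Fintype U] [Fintype X] [Fintype K] [Nonempty K]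
    (S : Finset (U → X)) {β : ℝ} (hβ : 0 ≤ β)
    (hS : β * (Fintype.card X : ℝ) ^ Fintype.card U ≤ #S) :
    β ^ (Fintype.card K ^ Fintype.card U) *
      (Fintype.card X : ℝ) ^ (Fintype.card U * Fintype.card K) ≤ #(blowUpMaps K S) := by
  let e := Fintype.equivFin U
  let S' : Finset (Fin (Fintype.card U) → X) := S.map (e.arrowCongr (Equiv.refl X)).toEmbedding
  refine (le_card_blowUpMaps_fin (K := K) _ S' hβ (by simpa [S'] using hS)).trans ?_
  have : #(blowUpMaps K S') ≤ #(blowUpMaps K S) := by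
    refine card_le_card_of_injOn (fun Ψ => Ψ ∘ e) (fun Ψ hΨ => ?_)
      (e.surjective.injective_comp_right.injOn)
    refine mem_coe.2 (mem_blowUpMaps.2 fun k => ?_)
    have h := mem_blowUpMaps.1 hΨ (k ∘ e.symm)
    obtain ⟨y, hy, hyΨ⟩ := mem_map.1 h
    convert hy using 1
    funext u
    have := congrFun hyΨ (e u)
    simpa using this.symm
  exact_mod_cast this

open Classical in
/-- The homomorphisms from `H` to `Γ`, given as maps of vertices. -/
noncomputable def homMaps [Fintype U] [Fintype X] (H : SimpleGraph U) (Γ : SimpleGraph X) :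
    Finset (U → X) :=
  {ψ | ∀ u v, H.Adj u v → Γ.Adj (ψ u) (ψ v)}

lemma mem_homMaps [Fintype U] [Fintype X] {H : SimpleGraph U} {Γ : SimpleGraph X} {ψ : U → X} :
    ψ ∈ homMaps H Γ ↔ ∀ u v, H.Adj u v → Γ.Adj (ψ u) (ψ v) := by
  classical simp [homMaps]

/-- The variant of abundance that counts homomorphisms in place of copies. For homomorphisms the
bound is required for all `n`, not only for large `n`. -/
def HomAbundant [Fintype U] (H : SimpleGraph U) (F : SimpleGraph V) : Prop :=
  ∃ (c : ℝ) (C : ℕ), 0 < c ∧ ∀ ε : ℝ, 0 < ε → ∀ (n : ℕ) (Γ : SimpleGraph (Fin n)),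
    Γ.FarFromFree F ε → c * ε ^ C * (n : ℝ) ^ Fintype.card U ≤ #(homMaps H Γ)

open Classical in
/-- A graph `H'` homomorphic to `H` lies in a blow-up of `H`, so abundance passes from `H` to
`H'`. -/
lemma HomAbundant.of_hom [Fintype U] [Fintype U'] {H : SimpleGraph U} {H' : SimpleGraph U'}
    {F : SimpleGraph V} (hH : HomAbundant H F) (f : H' →g H) : HomAbundant H' F := by
  rcases isEmpty_or_nonempty U' with hU' | hU'
  · refine ⟨1, 0, one_pos, fun ε _ n Γ _ => ?_⟩
    have : (homMaps H' Γ).Nonempty := ⟨isEmptyElim, mem_homMaps.2 isEmptyElim⟩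
    simpa using this.card_pos
  obtain ⟨c, C, hc, h⟩ := hH
  set M := Fintype.card U' ^ Fintype.card U with hM
  refine ⟨c ^ M, C * M, by positivity, fun ε hε n Γ hΓ => ?_⟩
  rcases Nat.eq_zero_or_pos n with rfl | hn
  · simp
  have hn0 : (0 : ℝ) < n := by exact_mod_cast hn
  have hblow := le_card_blowUpMaps (K := U') (homMaps H Γ) (β := c * ε ^ C) (by positivity)
    (by simpa using h ε hε n Γ hΓ)
  rw [Fintype.card_fin] at hblow
  -- A map on the blow-up is given by its restriction to the graph of `f`, which is a homomorphism
  -- from `H'`, and by its values at the remaining vertices `N`.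
  let N := {p : U × U' // ¬ p.1 = f p.2}
  have hN : Fintype.card U * Fintype.card U' = Fintype.card U' + Fintype.card N := by
    rw [← Fintype.card_prod, ← Fintype.card_congr (Equiv.sumCompl fun p : U × U' => p.1 = f p.2),
      Fintype.card_sum]
    congr 1
    refine (Fintype.card_congr ⟨fun p => p.1.2, fun u => ⟨(f u, u), rfl⟩, ?_, fun u => rfl⟩)
    rintro ⟨⟨u, u'⟩, hu⟩
    simpa using Eq.symm hu
  have hle : #(blowUpMaps U' (homMaps H Γ)) ≤ #(homMaps H' Γ ×ˢ (univ : Finset (N → Fin n))) := by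
    refine card_le_card_of_injOn (fun Ψ => (fun u' => Ψ (f u') u', fun p => Ψ p.1.1 p.1.2))
      (fun Ψ hΨ => ?_) ?_
    · refine mem_coe.2 (mem_product.2 ⟨mem_homMaps.2 fun u' v' huv => ?_, mem_univ _⟩)
      have hne : f v' ≠ f u' := (f.map_adj huv).ne'
      have := mem_homMaps.1 (mem_blowUpMaps.1 hΨ (fun u => if u = f u' then u' else v')) (f u')
        (f v') (f.map_adj huv)
      simpa [hne] using this
    · intro Ψ _ Φ _ heq
      simp only [Prod.mk.injEq] at heq
      funext u u'
      by_cases hu : u = f u'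
      · subst hu
        exact congrFun heq.1 u'
      · exact congrFun heq.2 ⟨(u, u'), hu⟩
  have hle' : (#(blowUpMaps U' (homMaps H Γ)) : ℝ) ≤
      #(homMaps H' Γ) * (n : ℝ) ^ Fintype.card N := by
    rw [card_product, card_univ, Fintype.card_fun, Fintype.card_fin] at hle
    exact_mod_cast hle
  refine le_of_mul_le_mul_right ?_ (pow_pos hn0 (Fintype.card N))
  refine le_trans (le_of_eq ?_) (hblow.trans hle')
  rw [hN, ← hM, pow_add, mul_pow, ← pow_mul]
  ring

/-- The lists `univ` impose no restriction, so list-avoidability gives an abundant graph that is not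
homomorphic to `G`. -/
lemma exists_homAbundant [Fintype V] [Fintype W] [Nonempty W] {F : SimpleGraph V}
    {G : SimpleGraph W} (hFG : IsEmpty (F →g G)) :
    ∃ (U : Type w) (_ : Fintype U) (H : SimpleGraph U), HomAbundant H F ∧ IsEmpty (H →g G) := by
  obtain ⟨v, v', hv⟩ : ∃ v v', F.Adj v v' := by
    by_contra! h
    exact hFG.elim ⟨fun _ => Classical.arbitrary W, fun {a b} hab => (h a b hab).elim⟩
  obtain ⟨U, _, H, τ, hcol, c, C, hc, hcount⟩ := listAvoidable_univ hFG
  have hV : (0 : ℝ) < (Fintype.card V : ℝ) ^ 2 := by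
    have : 0 < Fintype.card V := Fintype.card_pos_iff.2 ⟨v⟩
    positivity
  refine ⟨U, inferInstance, H, ⟨c * (1 / (Fintype.card V : ℝ) ^ 2) ^ C, C, by positivity,
    fun ε hε n Γ hΓ => ?_⟩, ⟨fun φ => ?_⟩⟩
  · obtain ⟨T, hT, hcard⟩ := hΓ.exists_packing hv
    rw [Fintype.card_fin] at hcard
    have := hcount n Γ T (ε / (Fintype.card V : ℝ) ^ 2) hT (by positivity)
      (by rw [div_mul_eq_mul_div, div_le_iff₀ hV]; exact hcard)
    rw [div_eq_mul_one_div, mul_pow] at this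
    have hsub : typedHoms H Γ τ T ⊆ homMaps H Γ := fun ψ hψ =>
      mem_homMaps.2 (mem_typedHoms.1 hψ).1
    have hsub' : (#(typedHoms H Γ τ T) : ℝ) ≤ #(homMaps H Γ) := by
      exact_mod_cast card_le_card hsub
    refine le_trans (le_of_eq ?_) (this.trans hsub')
    ring
  · obtain ⟨u, hu⟩ := hcol φ
    exact hu trivial

/-! ### Adding edges without short cycles -/

/-- A cycle through a new edge `ab` that starts with this edge returns from `b` to `a` in the old
graph. -/
lemma lt_length_cons_of_isCycle {H H' : SimpleGraph Y} {a b : Y} {ℓ : ℕ}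
    (hH' : ∀ x y, H'.Adj x y → H.Adj x y ∨ s(x, y) = s(a, b))
    (hwalk : ∀ p : H.Walk a b, ℓ < p.length) (h : H'.Adj a b) (p : H'.Walk b a)
    (hc : (Walk.cons h p).IsCycle) : ℓ < (Walk.cons h p).length := by
  have hp := (Walk.cons_isCycle_iff p h).1 hc
  have hpH : ∀ e ∈ p.edges, e ∈ H.edgeSet := by
    intro e he
    induction e with
    | _ x y =>
      rcases hH' x y (Walk.adj_of_mem_edges p he) with hxy | hxy
      · exact hxy
      · exact (hp.2 (hxy ▸ he)).elim
  have := hwalk (p.transfer H hpH).reverse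
  rw [Walk.length_reverse, Walk.length_transfer] at this
  rw [Walk.length_cons]
  omega

open Classical in
/-- Joining two vertices at distance greater than `ℓ` creates no cycle of length at most `ℓ`. -/
lemma lt_length_of_isCycle_of_add_edge {H H' : SimpleGraph Y} {a b : Y} {ℓ : ℕ}
    (hH' : ∀ x y, H'.Adj x y → H.Adj x y ∨ s(x, y) = s(a, b))
    (hwalk : ∀ p : H.Walk a b, ℓ < p.length)
    (hH : ∀ x (w : H.Walk x x), w.IsCycle → ℓ < w.length) :
    ∀ x (w : H'.Walk x x), w.IsCycle → ℓ < w.length := by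
  intro x w hw
  by_cases hab : s(a, b) ∈ w.edges
  · have ha : a ∈ w.support := Walk.fst_mem_support_of_mem_edges w hab
    have hab' : s(a, b) ∈ (w.rotate a ha).edges := (w.rotate_edges a ha).perm.mem_iff.2 hab
    have hc : (w.rotate a ha).IsCycle := (Walk.isCycle_rotate ha).2 hw
    rw [← Walk.length_rotate w a ha]
    generalize w.rotate a ha = c at hc hab'
    cases c with
    | nil => exact (Walk.not_isCycle_nil hc).elim
    | @cons _ z _ h p =>
      by_cases hz : z = b
      · subst hz
        exact lt_length_cons_of_isCycle hH' hwalk h p hc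
      · have hp := (Walk.cons_isCycle_iff p h).1 hc
        rw [Walk.edges_cons, List.mem_cons] at hab'
        rcases hab' with hab' | hab'
        · rcases Sym2.eq_iff.1 hab' with hab' | hab'
          · exact (hz hab'.2.symm).elim
          · exact (h.ne hab'.1).elim
        -- The new edge is the last one, so the reversed cycle starts with it.
        · have hrc := hc.reverse
          have hb : (Walk.cons h p).reverse.snd = b := by
            have hnil : ¬ p.Nil := by
              intro hnil
              rw [Walk.edges_eq_nil.2 hnil] at hab'
              simp at hab'
            rw [Walk.snd_reverse, Walk.penultimate_cons_of_not_nil _ _ hnil]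
            exact (hp.1.eq_penultimate_of_mem_edges hab').symm
          rw [← Walk.length_reverse]
          generalize (Walk.cons h p).reverse = c at hrc hb
          cases c with
          | nil => exact (Walk.not_isCycle_nil hrc).elim
          | cons h' p' =>
            rw [Walk.snd_cons] at hb
            subst hb
            exact lt_length_cons_of_isCycle hH' hwalk h' p' hrc
  · have hwH : ∀ e ∈ w.edges, e ∈ H.edgeSet := by
      intro e he
      induction e with
      | _ x y =>
        rcases hH' x y (Walk.adj_of_mem_edges w he) with hxy | hxy
        · exact hxy
        · exact (hab (hxy ▸ he)).elim
    have := hH x (w.transfer H hwH) (hw.transfer hwH)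
    rwa [Walk.length_transfer] at this

open Classical in
lemma card_ball_le [Fintype Y] {H : SimpleGraph Y} {Δ : ℕ} (hΔ : ∀ x, H.degree x ≤ Δ) (k : ℕ)
    (x : Y) : #{y | ∃ p : H.Walk x y, p.length ≤ k} ≤ (Δ + 1) ^ k := by
  induction k generalizing x with
  | zero =>
    rw [pow_zero, card_le_one]
    intro y hy z hz
    obtain ⟨p, hp⟩ := (mem_filter.1 hy).2
    obtain ⟨q, hq⟩ := (mem_filter.1 hz).2
    rw [← Walk.eq_of_length_eq_zero (Nat.le_zero.1 hp),
      ← Walk.eq_of_length_eq_zero (Nat.le_zero.1 hq)]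
  | succ k ih =>
    have hsub : ({y | ∃ p : H.Walk x y, p.length ≤ k + 1} : Finset Y) ⊆
        insert x ((H.neighborFinset x).biUnion fun z => {y | ∃ p : H.Walk z y, p.length ≤ k}) := by
      intro y hy
      obtain ⟨p, hp⟩ := (mem_filter.1 hy).2
      cases p with
      | nil => exact mem_insert_self _ _
      | @cons _ z _ h p =>
        refine mem_insert_of_mem (mem_biUnion.2 ⟨z, (H.mem_neighborFinset x z).2 h,
          mem_filter.2 ⟨mem_univ _, p, ?_⟩⟩)
        rw [Walk.length_cons] at hp
        omega
    refine (card_le_card hsub).trans ((card_insert_le _ _).trans ?_)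
    have h1 := card_biUnion_le_card_mul (H.neighborFinset x)
      (fun z => ({y | ∃ p : H.Walk z y, p.length ≤ k} : Finset Y)) _ fun z _ => ih z
    rw [card_neighborFinset_eq_degree] at h1
    calc _ ≤ Δ * (Δ + 1) ^ k + 1 := by gcongr; exact h1.trans (Nat.mul_le_mul_right _ (hΔ x))
      _ ≤ Δ * (Δ + 1) ^ k + (Δ + 1) ^ k := by gcongr; exact Nat.one_le_pow _ _ (by omega)
      _ = (Δ + 1) ^ (k + 1) := by ring

open Classical in
/-- The pairs that cannot be joined if cycles of length at most `ℓ` and degrees above `Δ` are to be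
avoided. -/
noncomputable def blockedPairs [Fintype Y] (H : SimpleGraph Y) (Δ ℓ : ℕ) : Finset (Y × Y) :=
  {p | Δ ≤ H.degree p.1 ∨ Δ ≤ H.degree p.2 ∨ ∃ w : H.Walk p.1 p.2, w.length ≤ ℓ}

open Classical in
lemma mul_card_blockedPairs_le [Fintype Y] {H : SimpleGraph Y} {Δ ℓ : ℕ}
    (hΔ : ∀ x, H.degree x ≤ Δ) :
    Δ * #(blockedPairs H Δ ℓ) ≤
      4 * Fintype.card Y * #H.edgeFinset + Δ * (Fintype.card Y * (Δ + 1) ^ ℓ) := by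
  let D : Finset Y := {x | Δ ≤ H.degree x}
  have hD : Δ * #D ≤ 2 * #H.edgeFinset := by
    rw [← H.sum_degrees_eq_twice_card_edges, mul_comm]
    refine (card_nsmul_le_sum D _ Δ fun x hx => (mem_filter.1 hx).2).trans ?_
    exact sum_le_sum_of_subset (subset_univ D)
  have hsub : blockedPairs H Δ ℓ ⊆ D ×ˢ univ ∪ univ ×ˢ D ∪
      (univ : Finset Y).biUnion fun x =>
        ({y | ∃ p : H.Walk x y, p.length ≤ ℓ} : Finset Y).image (Prod.mk x) := by
    rintro ⟨x, y⟩ hxy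
    rcases (mem_filter.1 hxy).2 with h | h | h
    · simp [D, show Δ ≤ H.degree x from h]
    · simp [D, show Δ ≤ H.degree y from h]
    · refine mem_union_right _ (mem_biUnion.2 ⟨x, mem_univ _, mem_image.2 ⟨y, ?_, rfl⟩⟩)
      exact mem_filter.2 ⟨mem_univ _, h⟩
  have hball : #((univ : Finset Y).biUnion fun x =>
        ({y | ∃ p : H.Walk x y, p.length ≤ ℓ} : Finset Y).image (Prod.mk x)) ≤
      Fintype.card Y * (Δ + 1) ^ ℓ :=
    card_biUnion_le_card_mul _ _ _ fun x _ => card_image_le.trans (card_ball_le hΔ ℓ x)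
  have hcard : #(blockedPairs H Δ ℓ) ≤ 2 * Fintype.card Y * #D + Fintype.card Y * (Δ + 1) ^ ℓ := by
    refine (card_le_card hsub).trans ((card_union_le _ _).trans (add_le_add ?_ hball))
    refine (card_union_le _ _).trans ?_
    rw [card_product, card_product, card_univ]
    exact le_of_eq (by ring)
  calc Δ * #(blockedPairs H Δ ℓ)
      ≤ Δ * (2 * Fintype.card Y * #D + Fintype.card Y * (Δ + 1) ^ ℓ) := by gcongr
    _ = 2 * Fintype.card Y * (Δ * #D) + Δ * (Fintype.card Y * (Δ + 1) ^ ℓ) := by ring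
    _ ≤ 2 * Fintype.card Y * (2 * #H.edgeFinset) + Δ * (Fintype.card Y * (Δ + 1) ^ ℓ) := by gcongr
    _ = _ := by ring

/-! ### Sparse incomparability -/

open Classical in
/-- The edges of the blow-up of `H₀` with parts of size `N` that the colouring `φ` violates. -/
noncomputable def violatedPairs [Fintype U] {N : ℕ} (H₀ : SimpleGraph U) (G : SimpleGraph W)
    (φ : U × Fin N → W) : Finset ((U × Fin N) × (U × Fin N)) :=
  {p | H₀.Adj p.1.1 p.2.1 ∧ ¬ G.Adj (φ p.1) (φ p.2)}

open Classical in
/-- The most frequent colours of the parts do not form a homomorphism, so every colouring violates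
many edges of the blow-up. -/
lemma sq_le_card_violatedPairs [Fintype U] [Fintype W] {H₀ : SimpleGraph U} {G : SimpleGraph W}
    (hH₀ : IsEmpty (H₀ →g G)) {q : ℕ} (φ : U × Fin (Fintype.card W * q) → W) [Nonempty W] :
    q ^ 2 ≤ #(violatedPairs H₀ G φ) := by
  have hc : ∀ u, ∃ c, q ≤ #{k | φ (u, k) = c} := by
    intro u
    obtain ⟨c, -, hc⟩ := exists_le_card_fiber_of_mul_le_card_of_maps_to
      (s := (univ : Finset (Fin (Fintype.card W * q)))) (t := (univ : Finset W))
      (f := fun k => φ (u, k)) (n := q) (by simp) univ_nonempty (by simp)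
    exact ⟨c, hc⟩
  choose c hc using hc
  obtain ⟨u, v, huv, hG⟩ : ∃ u v, H₀.Adj u v ∧ ¬ G.Adj (c u) (c v) := by
    by_contra! h
    exact hH₀.elim ⟨c, fun {u v} huv => h u v huv⟩
  calc q ^ 2 ≤ #{k | φ (u, k) = c u} * #{k | φ (v, k) = c v} := by
        rw [sq]; exact Nat.mul_le_mul (hc u) (hc v)
    _ = #(({k | φ (u, k) = c u} : Finset _) ×ˢ ({k | φ (v, k) = c v} : Finset _)) :=
        (card_product _ _).symm
    _ ≤ _ := by
        refine card_le_card_of_injOn (fun p => ((u, p.1), (v, p.2))) ?_ ?_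
        · intro p hp
          obtain ⟨h1, h2⟩ := mem_product.1 hp
          refine mem_coe.2 (mem_filter.2 ⟨mem_univ _, huv, ?_⟩)
          rwa [(mem_filter.1 h1).2, (mem_filter.1 h2).2]
        · rintro ⟨k, k'⟩ _ ⟨m, m'⟩ _ h
          simpa using h

/-- If each of the sets `B φ` has at least `b` elements outside `D`, then by averaging some element
outside `D` lies in a positive proportion of them. -/
lemma exists_mem_of_le_card_sdiff {Φ P : Type*} [Fintype P] [DecidableEq P]
    (S : Finset Φ) (hS : S.Nonempty)
    (B : Φ → Finset P) (D : Finset P) {b : ℝ} (hb : 0 < b) (h : ∀ φ ∈ S, b ≤ #(B φ \ D)) :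
    ∃ p, p ∉ D ∧ b / Fintype.card P * #S ≤ #{φ ∈ S | p ∈ B φ} := by
  have hsum : b * #S ≤ ∑ p ∈ univ \ D, (#{φ ∈ S | p ∈ B φ} : ℝ) := by
    have h1 : ∑ φ ∈ S, #(B φ \ D) = ∑ p ∈ univ \ D, #{φ ∈ S | p ∈ B φ} := by
      have := sum_card_bipartiteAbove_eq_sum_card_bipartiteBelow (s := S) (t := univ \ D)
        (fun φ p => p ∈ B φ)
      refine Eq.trans (sum_congr rfl fun φ _ => congrArg card ?_) this
      ext p
      simp [bipartiteAbove, and_comm]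
    calc b * #S = ∑ φ ∈ S, b := by rw [sum_const, nsmul_eq_mul, mul_comm]
      _ ≤ ∑ φ ∈ S, (#(B φ \ D) : ℝ) := sum_le_sum h
      _ = _ := by exact_mod_cast h1
  have hS0 : (0 : ℝ) < #S := by exact_mod_cast hS.card_pos
  have hne : (univ \ D).Nonempty := by
    rw [nonempty_iff_ne_empty]
    intro hempty
    rw [hempty, sum_empty] at hsum
    nlinarith
  have hP : (0 : ℝ) < Fintype.card P := by
    obtain ⟨p, -⟩ := hne
    exact_mod_cast Fintype.card_pos_iff.2 ⟨p⟩
  obtain ⟨p, hp, hle⟩ := exists_le_of_sum_le (s := univ \ D)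
    (f := fun _ => b / Fintype.card P * #S) (g := fun p => (#{φ ∈ S | p ∈ B φ} : ℝ)) hne (by
      refine le_trans ?_ hsum
      rw [sum_const, nsmul_eq_mul]
      have hcard : (#(univ \ D) : ℝ) ≤ Fintype.card P := by exact_mod_cast card_le_univ _
      calc (#(univ \ D) : ℝ) * (b / Fintype.card P * #S)
          ≤ Fintype.card P * (b / Fintype.card P * #S) := by gcongr
        _ = b * #S := by field_simp)
  exact ⟨p, (mem_sdiff.1 hp).2, hle⟩

open Classical in
lemma degree_le_of_add_edge [Fintype Y] {H H' : SimpleGraph Y} {a b : Y}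
    (hH' : ∀ x y, H'.Adj x y → H.Adj x y ∨ s(x, y) = s(a, b)) {Δ : ℕ}
    (hΔ : ∀ x, H.degree x ≤ Δ) (ha : H.degree a < Δ) (hb : H.degree b < Δ) (x : Y) :
    H'.degree x ≤ Δ := by
  by_cases hx : x = a ∨ x = b
  · obtain ⟨y, hy⟩ : ∃ y, H'.neighborFinset x ⊆ insert y (H.neighborFinset x) := by
      rcases hx with rfl | rfl
      · refine ⟨b, fun z hz => ?_⟩
        rw [mem_neighborFinset] at hz
        rcases hH' _ _ hz with h | h
        · exact mem_insert_of_mem ((H.mem_neighborFinset _ _).2 h)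
        · rw [Sym2.congr_right] at h
          exact h ▸ mem_insert_self _ _
      · refine ⟨a, fun z hz => ?_⟩
        rw [mem_neighborFinset] at hz
        rcases hH' _ _ hz with h | h
        · exact mem_insert_of_mem ((H.mem_neighborFinset _ _).2 h)
        · rw [Sym2.eq_swap, Sym2.congr_left] at h
          exact h ▸ mem_insert_self _ _
    have hlt : H.degree x < Δ := by
      rcases hx with rfl | rfl
      exacts [ha, hb]
    rw [← card_neighborFinset_eq_degree] at hlt ⊢
    exact (card_le_card hy).trans ((card_insert_le _ _).trans hlt)
  · refine le_trans (card_le_card fun z hz => ?_) (hΔ x)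
    rw [mem_neighborFinset] at hz ⊢
    rcases hH' _ _ hz with h | h
    · exact h
    · rcases Sym2.eq_iff.1 h with h | h
      · exact (hx (Or.inl h.1)).elim
      · exact (hx (Or.inr h.1)).elim

open Classical in
/-- One step of the greedy construction: unless no colouring remains, an edge of the blow-up is
added that creates no short cycle and no large degree and that violates a positive proportion of
the remaining colourings. -/
lemma exists_add_edge [Fintype U] [Fintype W] [Nonempty W] {H₀ : SimpleGraph U} {G : SimpleGraph W}
    (hH₀ : IsEmpty (H₀ →g G)) {q Δ ℓ : ℕ} (hq : 0 < q)
    {H : SimpleGraph (U × Fin (Fintype.card W * q))}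
    (hproj : ∀ x y, H.Adj x y → H₀.Adj x.1 y.1)
    (hgirth : ∀ x (w : H.Walk x x), w.IsCycle → ℓ < w.length) (hΔ : ∀ x, H.degree x ≤ Δ)
    (hblocked : 2 * #(blockedPairs H Δ ℓ) ≤ q ^ 2) :
    ∃ H' : SimpleGraph (U × Fin (Fintype.card W * q)), (∀ x y, H'.Adj x y → H₀.Adj x.1 y.1) ∧
      (∀ x (w : H'.Walk x x), w.IsCycle → ℓ < w.length) ∧ (∀ x, H'.degree x ≤ Δ) ∧
      #H'.edgeFinset ≤ #H.edgeFinset + 1 ∧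
      (#(homMaps H' G) : ℝ) ≤
        (1 - 1 / (2 * (Fintype.card U * Fintype.card W : ℝ) ^ 2)) * #(homMaps H G) := by
  rcases (homMaps H G).eq_empty_or_nonempty with hempty | hne
  · exact ⟨H, hproj, hgirth, hΔ, by omega, by simp [hempty]⟩
  obtain ⟨p, hpD, hp⟩ := exists_mem_of_le_card_sdiff (homMaps H G) hne (violatedPairs H₀ G)
    (blockedPairs H Δ ℓ) (b := (q : ℝ) ^ 2 / 2) (by positivity) (by
      intro φ _
      have h1 := sq_le_card_violatedPairs hH₀ φ
      have h2 := le_card_sdiff (blockedPairs H Δ ℓ) (violatedPairs H₀ G φ)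
      have h3 : q ^ 2 ≤ 2 * #(violatedPairs H₀ G φ \ blockedPairs H Δ ℓ) := by omega
      have h4 : (q : ℝ) ^ 2 ≤ 2 * #(violatedPairs H₀ G φ \ blockedPairs H Δ ℓ) := by
        exact_mod_cast h3
      linarith)
  obtain ⟨a, b⟩ := p
  have hU : 0 < Fintype.card U := Fintype.card_pos_iff.2 ⟨a.1⟩
  have hW : 0 < Fintype.card W := Fintype.card_pos
  have hpos : (0 : ℝ) < #{φ ∈ homMaps H G | (a, b) ∈ violatedPairs H₀ G φ} := by
    refine lt_of_lt_of_le ?_ hp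
    have : 0 < #(homMaps H G) := hne.card_pos
    have : 0 < Fintype.card ((U × Fin (Fintype.card W * q)) × (U × Fin (Fintype.card W * q))) :=
      Fintype.card_pos_iff.2 ⟨(a, b)⟩
    positivity
  obtain ⟨φ, hφ⟩ := card_pos.1 (Nat.cast_pos.1 hpos)
  have hab : H₀.Adj a.1 b.1 := (mem_filter.1 (mem_filter.1 hφ).2).2.1
  simp only [blockedPairs, mem_filter, mem_univ, true_and, not_or, not_le, not_exists] at hpD
  obtain ⟨ha, hb, hwalk⟩ := hpD
  obtain ⟨H', hle, hH'ab, hH'⟩ : ∃ H' : SimpleGraph (U × Fin (Fintype.card W * q)), H ≤ H' ∧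
      H'.Adj a b ∧ ∀ x y, H'.Adj x y → H.Adj x y ∨ s(x, y) = s(a, b) := by
    refine ⟨H ⊔ fromEdgeSet {s(a, b)}, le_sup_left, Or.inr ((fromEdgeSet_adj _).2
      ⟨rfl, fun h => hab.ne (congrArg Prod.fst h)⟩), fun x y h => ?_⟩
    rcases h with h | h
    exacts [Or.inl h, Or.inr ((fromEdgeSet_adj _).1 h).1]
  refine ⟨H', ?_, lt_length_of_isCycle_of_add_edge hH' hwalk hgirth,
    degree_le_of_add_edge hH' hΔ ha hb, ?_, ?_⟩
  · intro x y h
    rcases hH' x y h with h | h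
    · exact hproj x y h
    · rcases Sym2.eq_iff.1 h with ⟨rfl, rfl⟩ | ⟨rfl, rfl⟩
      exacts [hab, hab.symm]
  · refine (card_le_card (t := insert s(a, b) H.edgeFinset) ?_).trans (card_insert_le _ _)
    intro e he
    induction e with
    | _ x y =>
      rw [mem_edgeFinset] at he
      rcases hH' x y he with h | h
      · exact mem_insert_of_mem (mem_edgeFinset.2 h)
      · exact h ▸ mem_insert_self _ _
  · have hsub : homMaps H' G ⊆
        homMaps H G \ {φ ∈ homMaps H G | (a, b) ∈ violatedPairs H₀ G φ} := by
      intro ψ hψ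
      rw [mem_homMaps] at hψ
      refine mem_sdiff.2 ⟨mem_homMaps.2 fun x y h => hψ x y (hle h), fun hmem => ?_⟩
      exact (mem_filter.1 (mem_filter.1 hmem).2).2.2 (hψ a b hH'ab)
    have hcard : (#(homMaps H' G) : ℝ) + #{φ ∈ homMaps H G | (a, b) ∈ violatedPairs H₀ G φ} ≤
        #(homMaps H G) := by
      have h1 := card_le_card hsub
      have h2 := card_sdiff_add_card_eq_card
        (filter_subset (fun φ => (a, b) ∈ violatedPairs H₀ G φ) (homMaps H G))
      have h3 : #(homMaps H' G) + #{φ ∈ homMaps H G | (a, b) ∈ violatedPairs H₀ G φ} ≤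
        #(homMaps H G) := by omega
      exact_mod_cast h3
    have hconst : (q : ℝ) ^ 2 / 2 /
        Fintype.card ((U × Fin (Fintype.card W * q)) × (U × Fin (Fintype.card W * q))) =
        1 / (2 * (Fintype.card U * Fintype.card W : ℝ) ^ 2) := by
      simp only [Fintype.card_prod, Fintype.card_fin, Nat.cast_mul]
      field_simp
    rw [hconst] at hp
    linarith

open Classical in
/-- The **sparse incomparability lemma**: edges of a blow-up of `H₀` are added greedily, each of
which violates a positive proportion of the remaining colourings by `G`, until none remains.
Linearly many edges suffice, so only few pairs are blocked in the process. -/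
lemma exists_lt_egirth_hom [Fintype U] [Fintype W] [Nonempty W] {H₀ : SimpleGraph U}
    {G : SimpleGraph W} (hH₀ : IsEmpty (H₀ →g G)) (ℓ : ℕ) :
    ∃ (N : ℕ) (H : SimpleGraph (U × Fin N)), (∀ x y, H.Adj x y → H₀.Adj x.1 y.1) ∧
      (ℓ : ℕ∞) < H.egirth ∧ IsEmpty (H →g G) := by
  have hU : 0 < Fintype.card U := by
    rw [Fintype.card_pos_iff]
    by_contra h
    rw [not_nonempty_iff] at h
    exact hH₀.elim ⟨isEmptyElim, fun {a} => isEmptyElim a⟩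
  have hW : 0 < Fintype.card W := Fintype.card_pos
  set m := Fintype.card U * Fintype.card W with hm
  have hm0 : 0 < m := by positivity
  set σ : ℝ := 1 / (2 * (Fintype.card U * Fintype.card W : ℝ) ^ 2) with hσ
  have hσ0 : 0 < σ := by positivity
  have hσ1 : 0 ≤ 1 - σ := by
    have h1 : (1 : ℝ) ≤ (m : ℝ) := by exact_mod_cast hm0
    have h2 : σ ≤ 1 := by
      rw [hσ, div_le_one (by positivity)]
      rw [hm, Nat.cast_mul] at h1
      nlinarith
    linarith
  -- `K * q` edges suffice to violate all colourings of a blow-up with parts of size `card W * q`.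
  obtain ⟨K, hK⟩ := exists_pow_lt_of_lt_one (show (0 : ℝ) < 1 / (Fintype.card W : ℝ) ^ m by
    positivity) (show 1 - σ < 1 by linarith)
  -- At most `2 * K * q / Δ` vertices reach degree `Δ`, and the balls of radius `ℓ` have at most
  -- `(Δ + 1) ^ ℓ` elements, so with these choices at most `q ^ 2 / 2` pairs are ever blocked.
  set Δ := 16 * K * m + 1 with hΔ
  set q := 4 * m * (Δ + 1) ^ ℓ with hq
  have hq0 : 0 < q := by positivity
  have hcardY : Fintype.card (U × Fin (Fintype.card W * q)) = m * q := by
    rw [Fintype.card_prod, Fintype.card_fin, hm, mul_assoc]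
  have hgreedy : ∀ M ≤ K * q, ∃ H : SimpleGraph (U × Fin (Fintype.card W * q)),
      (∀ x y, H.Adj x y → H₀.Adj x.1 y.1) ∧
      (∀ x (w : H.Walk x x), w.IsCycle → ℓ < w.length) ∧ (∀ x, H.degree x ≤ Δ) ∧
      #H.edgeFinset ≤ M ∧
      (#(homMaps H G) : ℝ) ≤ (1 - σ) ^ M * (Fintype.card W : ℝ) ^ (m * q) := by
    intro M
    induction M with
    | zero =>
      intro _
      refine ⟨⊥, fun x y h => h.elim, fun x w hw => ?_, fun x => by simp, by simp, ?_⟩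
      · cases w with
        | nil => exact (Walk.not_isCycle_nil hw).elim
        | cons h p => exact h.elim
      · have h := card_le_univ (homMaps (⊥ : SimpleGraph (U × Fin (Fintype.card W * q))) G)
        rw [Fintype.card_fun, hcardY] at h
        rw [pow_zero, one_mul]
        exact_mod_cast h
    | succ M ih =>
      intro hM
      obtain ⟨H, hproj, hgirth, hdeg, hedges, hhom⟩ := ih (by omega)
      have hblocked : 2 * #(blockedPairs H Δ ℓ) ≤ q ^ 2 := by
        have h1 := mul_card_blockedPairs_le (ℓ := ℓ) hdeg
        rw [hcardY] at h1
        have h2 : #H.edgeFinset ≤ K * q := by omega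
        have h3 : Δ * (4 * #(blockedPairs H Δ ℓ)) ≤ Δ * (2 * q ^ 2) := by
          calc Δ * (4 * #(blockedPairs H Δ ℓ)) = 4 * (Δ * #(blockedPairs H Δ ℓ)) := by ring
            _ ≤ 4 * (4 * (m * q) * (K * q) + Δ * (m * q * (Δ + 1) ^ ℓ)) := by
                refine Nat.mul_le_mul_left 4 (h1.trans ?_)
                gcongr
            _ = (16 * K * m) * q ^ 2 + Δ * (q * (4 * m * (Δ + 1) ^ ℓ)) := by ring
            _ ≤ Δ * q ^ 2 + Δ * (q * q) := by
                rw [← hq]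
                gcongr
                omega
            _ = Δ * (2 * q ^ 2) := by ring
        have h4 := Nat.le_of_mul_le_mul_left h3 (by omega)
        omega
      obtain ⟨H', hproj', hgirth', hdeg', hedges', hhom'⟩ :=
        exists_add_edge hH₀ hq0 hproj hgirth hdeg hblocked
      refine ⟨H', hproj', hgirth', hdeg', by omega, hhom'.trans ?_⟩
      rw [pow_succ' (1 - σ) M, mul_assoc]
      exact mul_le_mul_of_nonneg_left hhom hσ1
  obtain ⟨H, hproj, hgirth, -, -, hhom⟩ := hgreedy (K * q) le_rfl
  refine ⟨_, H, hproj, ?_, ⟨fun φ => ?_⟩⟩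
  · rw [← ENat.add_one_le_iff (ENat.natCast_ne_top ℓ), le_egirth]
    intro x w hw
    exact_mod_cast hgirth x w hw
  · have hlt : (#(homMaps H G) : ℝ) < 1 := by
      refine hhom.trans_lt ?_
      rw [pow_mul (1 - σ) K q, pow_mul _ m q, ← mul_pow]
      refine pow_lt_one₀ (by positivity) ?_ hq0.ne'
      rwa [← lt_div_iff₀ (by positivity)]
    have hpos : 0 < #(homMaps H G) :=
      card_pos.2 ⟨φ, mem_homMaps.2 fun x y h => φ.map_adj h⟩
    have : #(homMaps H G) < 1 := by exact_mod_cast hlt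
    omega

/-! ### From homomorphisms to copies -/

open Classical in
/-- All but `O(n ^ (m - 1))` maps from `m` vertices to `n` vertices are injective, and each
subgraph arises from at most `m ^ m` injective homomorphisms. -/
lemma HomAbundant.isAbundant {m : ℕ} {H : SimpleGraph (Fin m)} {F : SimpleGraph V}
    (hH : HomAbundant H F) : H.IsAbundant F := by
  obtain ⟨c, C, hc, h⟩ := hH
  rcases Nat.eq_zero_or_pos m with rfl | hm
  · refine ⟨1, 0, one_pos, fun ε _ => ⟨0, fun n _ Γ _ => ?_⟩⟩
    simp
  have hm0 : (0 : ℝ) < m := by exact_mod_cast hm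
  refine ⟨c / (2 * (m : ℝ) ^ m), C, by positivity, fun ε hε => ?_⟩
  obtain ⟨n₀, hn₀⟩ := exists_nat_ge ((m : ℝ) ^ 2 / (c / 2 * ε ^ C))
  refine ⟨n₀ + 1, fun n hn Γ hΓ => ?_⟩
  have hn1 : (0 : ℝ) < n := by exact_mod_cast (show 0 < n by omega)
  have hhom := h ε hε n Γ hΓ
  rw [Fintype.card_fin] at hhom ⊢
  -- A map that identifies `i` and `j` is determined by its values at the vertices other than `i`.
  let N : Finset (Fin m → Fin n) := {ψ | ¬ Function.Injective ψ}
  have hN : (#N : ℝ) ≤ (m : ℝ) ^ 2 * (n : ℝ) ^ (m - 1) := by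
    have hsub : N ⊆ ((univ : Finset (Fin m × Fin m)).filter fun p => p.1 ≠ p.2).biUnion
        fun p => {ψ | ψ p.1 = ψ p.2} := by
      intro ψ hψ
      have := (mem_filter.1 hψ).2
      simp only [Function.Injective, not_forall] at this
      obtain ⟨i, j, hij, hne⟩ := this
      exact mem_biUnion.2 ⟨(i, j), by simpa using hne, by simpa using hij⟩
    have h1 : #N ≤ m ^ 2 * n ^ (m - 1) := by
      refine (card_le_card hsub).trans ((card_biUnion_le_card_mul _ _ (n ^ (m - 1)) ?_).trans ?_)
      · rintro ⟨i, j⟩ hij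
        have hij : i ≠ j := (mem_filter.1 hij).2
        have : #(univ : Finset ({k // ¬ k = i} → Fin n)) = n ^ (m - 1) := by
          rw [card_univ, Fintype.card_fun, Fintype.card_fin, Fintype.card_subtype_compl,
            Fintype.card_fin, Fintype.card_subtype_eq]
        rw [← this]
        refine card_le_card_of_injOn (fun ψ k => ψ k) (by simp) ?_
        intro ψ hψ φ hφ heq
        have hψ : ψ i = ψ j := (mem_filter.1 (mem_coe.1 hψ)).2
        have hφ : φ i = φ j := (mem_filter.1 (mem_coe.1 hφ)).2
        have hne : ∀ k, k ≠ i → ψ k = φ k := fun k hk => congrFun heq ⟨k, hk⟩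
        funext k
        by_cases hk : k = i
        · rw [hk, hψ, hφ, hne j hij.symm]
        · exact hne k hk
      · refine Nat.mul_le_mul_right _ ((card_le_univ _).trans ?_)
        simp [sq]
    exact_mod_cast h1
  have hinj : (#(homMaps H Γ \ N) : ℝ) ≤ (m : ℝ) ^ m * Γ.copyCount H := by
    have h1 : #(homMaps H Γ \ N) ≤ #(univ : Finset (H.Copy Γ)) := by
      refine le_trans (card_le_card fun ψ hψ => ?_)
        (card_image_le (s := univ) (f := fun f : H.Copy Γ => (f : Fin m → Fin n)))
      obtain ⟨hψ, hψN⟩ := mem_sdiff.1 hψ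
      have hψinj : Function.Injective ψ := by simpa [N] using hψN
      exact mem_image.2 ⟨⟨⟨ψ, fun {u v} huv => mem_homMaps.1 hψ u v huv⟩, hψinj⟩, mem_univ _, rfl⟩
    have h2 : #(univ : Finset (H.Copy Γ)) ≤ m ^ m * Γ.copyCount H := by
      rw [copyCount_eq_card_image_copyToSubgraph]
      refine card_le_mul_card_image _ _ fun S hS => ?_
      obtain ⟨f₀, -, rfl⟩ := mem_image.1 hS
      have h3 : #(Fintype.piFinset fun _ : Fin m => univ.image f₀) ≤ m ^ m := by
        rw [Fintype.card_piFinset, prod_const, card_univ, Fintype.card_fin]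
        refine Nat.pow_le_pow_left (card_image_le.trans ?_) m
        simp
      refine le_trans (card_le_card_of_injOn (fun f => (f : Fin m → Fin n)) (fun f hf => ?_)
        (DFunLike.coe_injective.injOn)) h3
      have hf : f.toSubgraph = f₀.toSubgraph := (mem_filter.1 (mem_coe.1 hf)).2
      refine mem_coe.2 (Fintype.mem_piFinset.2 fun v => ?_)
      have hv : f v ∈ f.toSubgraph.verts := ⟨v, trivial, rfl⟩
      rw [hf] at hv
      obtain ⟨w, -, hw⟩ := hv
      exact mem_image.2 ⟨w, mem_univ _, hw⟩
    exact_mod_cast h1.trans h2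
  have hsplit : (#(homMaps H Γ) : ℝ) ≤ #(homMaps H Γ \ N) + #N := by
    have := card_le_card_sdiff_add_card (s := homMaps H Γ) (t := N)
    exact_mod_cast this
  have hsmall : (m : ℝ) ^ 2 * (n : ℝ) ^ (m - 1) ≤ c / 2 * ε ^ C * (n : ℝ) ^ m := by
    rw [div_le_iff₀ (by positivity)] at hn₀
    have hn' : (n₀ : ℝ) ≤ n := by exact_mod_cast (show n₀ ≤ n by omega)
    calc (m : ℝ) ^ 2 * (n : ℝ) ^ (m - 1) ≤ (n * (c / 2 * ε ^ C)) * (n : ℝ) ^ (m - 1) := by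
          gcongr
          exact hn₀.trans (by gcongr)
      _ = c / 2 * ε ^ C * ((n : ℝ) ^ (m - 1) * n) := by ring
      _ = c / 2 * ε ^ C * (n : ℝ) ^ m := by rw [pow_sub_one_mul hm.ne']
  have hmain : c / 2 * ε ^ C * (n : ℝ) ^ m ≤ (m : ℝ) ^ m * Γ.copyCount H := by linarith
  calc c / (2 * (m : ℝ) ^ m) * ε ^ C * (n : ℝ) ^ m
      = (c / 2 * ε ^ C * (n : ℝ) ^ m) / (m : ℝ) ^ m := by field_simp
    _ ≤ Γ.copyCount H := by
        rw [div_le_iff₀ (by positivity), mul_comm (Γ.copyCount H : ℝ)]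
        exact hmain

lemma homAbundant_bot_fin_one (F : SimpleGraph V) :
    HomAbundant (⊥ : SimpleGraph (Fin 1)) F := by
  refine ⟨1, 0, one_pos, fun ε _ n Γ _ => ?_⟩
  have : homMaps (⊥ : SimpleGraph (Fin 1)) Γ = univ :=
    eq_univ_iff_forall.2 fun ψ => mem_homMaps.2 fun u v h => h.elim
  rw [this, card_univ]
  simp

end SimpleGraph

theorem mainTheorem10 {V W : Type*} [Fintype V] [Fintype W] (ℓ : ℕ)
    (F : SimpleGraph V) (G : SimpleGraph W) (hFG : IsEmpty (F →g G)) :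
    ∃ (m : ℕ) (H : SimpleGraph (Fin m)),
      H.IsAbundant F ∧ (ℓ : ℕ∞) < H.egirth ∧ IsEmpty (H →g G) := by
  rcases isEmpty_or_nonempty W with hW | hW
  · exact ⟨1, ⊥, (SimpleGraph.homAbundant_bot_fin_one F).isAbundant, by simp,
      ⟨fun φ => isEmptyElim (φ 0)⟩⟩
  obtain ⟨U, _, H₀, hH₀, hH₀G⟩ := SimpleGraph.exists_homAbundant hFG
  obtain ⟨N, H, hproj, hgirth, hHG⟩ := SimpleGraph.exists_lt_egirth_hom hH₀G ℓ
  let e : Fin (Fintype.card (U × Fin N)) ≃ U × Fin N := (Fintype.equivFin _).symm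
  let i : H.comap e ≃g H := SimpleGraph.Iso.comap e H
  let f : H →g H₀ := ⟨Prod.fst, fun {x y} h => hproj x y h⟩
  exact ⟨_, H.comap e, (hH₀.of_hom (f.comp i.toHom)).isAbundant, by rwa [i.egirth_eq],
    ⟨fun φ => hHG.elim (φ.comp i.symm.toHom)⟩⟩
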